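/- Let $D,D'$ be Dedekind domains. Let $\mathrm{Princ}(D)$ denote the set of all ideals of $D$ of the form $\operatorname{rad}(xD)$ with $x\in D\setminus\{0\}$, partially ordered by inclusion, and define $\mathrm{Princ}(D')$ likewise. For an abelian group $G$, let $\operatorname{rk}G:=\dim_{\mathbb{Q}}(G\otimes_{\mathbb{Z}}\mathbb{Q})$, a (possibly infinite) cardinal number, and let $\operatorname{Cl}(D)$ be the ideal class group of $D$. If the partially ordered sets $\mathrm{Princ}(D)$ and $\mathrm{Princ}(D')$ are isomorphic, then $$\operatorname{rk}\operatorname{Cl}(D)=\operatorname{rk}\operatorname{Cl}(D').$$ -/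

import Mathlib

universe u v

open scoped TensorProduct

/-- The set of all ideals of `D` that are the radical of a nonzero principal ideal. Like any set of
ideals, it is partially ordered by inclusion. -/
def radPrincipal (D : Type*) [CommRing D] : Set (Ideal D) :=
  {I | ∃ x : D, x ≠ 0 ∧ I = (Ideal.span {x}).radical}

/-- The rank of an abelian group `G`: the dimension (a cardinal) of the rational vector space
`ℚ ⊗ G`, the tensor product being taken over `ℤ`. -/
noncomputable def abelianRank (G : Type*) [AddCommGroup G] : Cardinal :=
  Module.rank ℚ (ℚ ⊗[ℤ] G)

/-! Through zero loci, radicals of nonzero principal ideals become finite sets of maximal ideals,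
with order reversed. These sets are closed under union and separate points from finite sets, so an
order isomorphism between two such families comes from a bijection of maximal ideals
(`exists_equiv_of_orderIso`). A finite set is such a locus exactly when the classes of its members
in `ℚ ⊗ Cl` satisfy a relation with strictly positive coefficients
(`mem_principalLoci_iff_isPosSupport`), because an ideal of torsion class has a principal power.

It remains to read the dimension off the positive supports of a spanning family
(`lift_rank_le_of_isPosSupport_iff`). They decide membership in spans (`IsPosSupport.insert_iff`),
and chains of them measure the relations on a finite support (`finrank_relationsOn_le`), hence its
span by rank-nullity. In infinite rank, counting suffices. -/

/-! ### Positive relations in vector spaces over an ordered field -/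

section PosSupport

variable {K : Type*} [Field K] [LinearOrder K] [IsStrictOrderedRing K]
  {P : Type*} {V : Type*} [AddCommGroup V] [Module K V]
  {W : Type*} [AddCommGroup W] [Module K W]

/-- `A` is the support of a linear relation with nonnegative coefficients among the vectors of the
family `v`. -/
def IsPosSupport (K : Type*) [Field K] [LinearOrder K] {P V : Type*} [AddCommGroup V] [Module K V]
    (v : P → V) (A : Finset P) : Prop :=
  ∃ c : P →₀ K, (∀ p, 0 ≤ c p) ∧ c.support = A ∧ Finsupp.linearCombination K v c = 0

/-- The linear relations among the vectors of the family `v` that are supported in `A`. -/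
noncomputable def relationsOn (K : Type*) [Field K] {P V : Type*} [AddCommGroup V] [Module K V]
    (v : P → V) (A : Finset P) : Submodule K (P →₀ K) :=
  Finsupp.supported K K (A : Set P) ⊓ LinearMap.ker (Finsupp.linearCombination K v)

omit [LinearOrder K] [IsStrictOrderedRing K] in
theorem mem_relationsOn {v : P → V} {A : Finset P} {c : P →₀ K} :
    c ∈ relationsOn K v A ↔ c.support ⊆ A ∧ Finsupp.linearCombination K v c = 0 := by
  simp [relationsOn, Finsupp.mem_supported]

omit [LinearOrder K] [IsStrictOrderedRing K] in
theorem relationsOn_mono (v : P → V) {A B : Finset P} (h : A ⊆ B) :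
    relationsOn K v A ≤ relationsOn K v B := fun c hc => by
  rw [mem_relationsOn] at hc ⊢
  exact ⟨hc.1.trans h, hc.2⟩

omit [IsStrictOrderedRing K] in
theorem isPosSupport_empty (v : P → V) : IsPosSupport K v ∅ :=
  ⟨0, by simp, by simp, by simp⟩

/-- Adding a large multiple of a positive relation with support `A` to a relation that is
nonnegative outside `A` gives a positive relation. -/
theorem IsPosSupport.union_support [DecidableEq P] {v : P → V} {A : Finset P}
    (hA : IsPosSupport K v A) {r : P →₀ K} (hr : Finsupp.linearCombination K v r = 0)
    (hpos : ∀ p ∉ A, 0 ≤ r p) : IsPosSupport K v (A ∪ r.support) := by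
  obtain ⟨s, hs0, rfl, hs⟩ := hA
  -- `M` bounds every `-r p / s p`, so the multiple `M + 1` makes each coefficient on `A` strictly
  -- positive.
  obtain ⟨M, hM⟩ := (s.support.image fun p => -(r p) / s p).exists_le
  have key : ∀ p ∈ s.support, 0 < r p + (M + 1) * s p := by
    intro p hp
    have h1 : 0 < s p := lt_of_le_of_ne (hs0 p) (Finsupp.mem_support_iff.1 hp).symm
    have h2 := hM _ (Finset.mem_image_of_mem _ hp)
    rw [div_le_iff₀ h1] at h2
    linarith
  refine ⟨r + (M + 1) • s, fun p => ?_, ?_, by simp [hr, hs]⟩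
  · by_cases hp : p ∈ s.support
    · simpa using (key p hp).le
    · simpa [Finsupp.notMem_support_iff.1 hp] using hpos p hp
  · ext p
    by_cases hp : p ∈ s.support
    · simpa [Finsupp.mem_support_iff.1 hp] using (key p hp).ne'
    · simp [Finsupp.notMem_support_iff.1 hp]

theorem IsPosSupport.union [DecidableEq P] {v : P → V} {A B : Finset P}
    (hA : IsPosSupport K v A) (hB : IsPosSupport K v B) : IsPosSupport K v (A ∪ B) := by
  obtain ⟨r, hr0, rfl, hr⟩ := hB
  exact hA.union_support hr fun p _ => hr0 p

/-- Membership in the span of a positive support can be read off from the positive supports. -/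
theorem IsPosSupport.insert_iff [DecidableEq P] {v : P → V} {A : Finset P}
    (hA : IsPosSupport K v A) (p : P) :
    IsPosSupport K v (insert p A) ↔ v p ∈ Submodule.span K (v '' A) := by
  constructor
  · rintro ⟨c, -, hcA, hc⟩
    have hp : c p ≠ 0 := by
      rw [← Finsupp.mem_support_iff, hcA]; exact Finset.mem_insert_self p A
    rw [← Finsupp.single_add_erase p c, map_add, Finsupp.linearCombination_single] at hc
    have h1 : Finsupp.linearCombination K v (c.erase p) ∈ Submodule.span K (v '' A) := by
      rw [Finsupp.mem_span_image_iff_linearCombination]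
      refine ⟨_, ?_, rfl⟩
      rw [Finsupp.mem_supported, Finsupp.support_erase, hcA, Finset.coe_subset]
      exact Finset.erase_insert_subset p A
    rw [← Submodule.smul_mem_iff _ hp, eq_neg_of_add_eq_zero_left hc]
    exact neg_mem h1
  · intro h
    by_cases hp : p ∈ A
    · rwa [Finset.insert_eq_of_mem hp]
    obtain ⟨a, ha, hav⟩ := (Finsupp.mem_span_image_iff_linearCombination K).1 h
    rw [Finsupp.mem_supported, Finset.coe_subset] at ha
    have ha' : ∀ q ∉ A, a q = 0 := fun q hq =>
      Finsupp.notMem_support_iff.1 fun h => hq (ha h)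
    -- This relation can be negative only inside `A`.
    have := hA.union_support (r := Finsupp.single p 1 - a) (by simp [hav]) (fun q hq => by
      simp only [Finsupp.coe_sub, Pi.sub_apply, ha' q hq, sub_zero, Finsupp.single_apply]
      split_ifs <;> simp)
    convert this using 1
    ext q
    by_cases hq : q ∈ A
    · simp [hq]
    · simp [hq, ha' q hq, Finsupp.single_apply, eq_comm]

/-- If no positive support lies strictly between `B` and the support `C` of a positive relation `t`,
then the relations supported in `C` are spanned by those supported in `B` together with `t`. -/
theorem relationsOn_le_sup_span {v : P → V} {B C : Finset P} (hB : IsPosSupport K v B)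
    (hBC : B ⊂ C) (hmin : ∀ E, IsPosSupport K v E → B ⊆ E → E ⊂ C → E = B)
    {t : P →₀ K} (ht0 : ∀ p, 0 ≤ t p) (htC : t.support = C)
    (ht : Finsupp.linearCombination K v t = 0) :
    relationsOn K v C ≤ relationsOn K v B ⊔ Submodule.span K {t} := by
  classical
  intro r hr
  rw [mem_relationsOn] at hr
  -- Subtracting the least ratio times `t` keeps `r` nonnegative off `B` and kills the coordinate
  -- `p`; the resulting positive support misses `p`, so minimality forces it to be `B`.
  obtain ⟨p, hp, hpmin⟩ := (C \ B).exists_min_image (fun p => r p / t p)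
    (Finset.sdiff_nonempty.2 hBC.2)
  have htpos : ∀ q ∈ C, 0 < t q := fun q hq =>
    lt_of_le_of_ne (ht0 q) (Finsupp.mem_support_iff.1 (htC ▸ hq)).symm
  set l := r p / t p with hl
  have hz : ∀ q ∉ C, (r - l • t) q = 0 := fun q hq => by
    have h1 : r q = 0 := Finsupp.notMem_support_iff.1 fun h => hq (hr.1 h)
    have h2 : t q = 0 := Finsupp.notMem_support_iff.1 fun h => hq (htC ▸ h)
    simp [h1, h2]
  rw [Finset.mem_sdiff] at hp
  have hp0 : (r - l • t) p = 0 := by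
    simp [hl, div_mul_cancel₀ _ (htpos p hp.1).ne']
  have hker : Finsupp.linearCombination K v (r - l • t) = 0 := by simp [hr.2, ht]
  have hE := hB.union_support hker (fun q hq => by
    by_cases hqC : q ∈ C
    · have h1 := hpmin q (Finset.mem_sdiff.2 ⟨hqC, hq⟩)
      rw [le_div_iff₀ (htpos q hqC)] at h1
      simpa using h1
    · exact (hz q hqC).ge)
  have hsub : B ∪ (r - l • t).support ⊆ C := Finset.union_subset hBC.1 fun q hq => by
    by_contra hqC
    exact Finsupp.mem_support_iff.1 hq (hz q hqC)
  have hEB := hmin _ hE Finset.subset_union_left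
    ((Finset.ssubset_iff_of_subset hsub).2 ⟨p, hp.1, by
      simpa only [Finset.mem_union, not_or, Finsupp.notMem_support_iff] using ⟨hp.2, hp0⟩⟩)
  rw [← sub_add_cancel r (l • t)]
  refine Submodule.add_mem_sup (mem_relationsOn.2 ⟨?_, hker⟩)
    (Submodule.smul_mem _ _ (Submodule.mem_span_singleton_self t))
  rw [← Finset.union_eq_left, hEB]

instance finiteDimensional_supported (A : Finset P) :
    FiniteDimensional K (Finsupp.supported K K (A : Set P)) :=
  Module.Finite.equiv (Finsupp.supportedEquivFinsupp (R := K) (M := K) (A : Set P)).symm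

instance finiteDimensional_relationsOn (v : P → V) (A : Finset P) :
    FiniteDimensional K (relationsOn K v A) :=
  Submodule.finiteDimensional_of_le (S₂ := Finsupp.supported K K (A : Set P)) inf_le_left

omit [LinearOrder K] [IsStrictOrderedRing K] in
theorem finrank_span_add_finrank_relationsOn (v : P → V) (A : Finset P) :
    Module.finrank K (Submodule.span K (v '' A)) + Module.finrank K (relationsOn K v A) =
      A.card := by
  have h := LinearMap.finrank_range_add_finrank_ker
    (K := K) (V := Finsupp.supported K K (A : Set P)) (V₂ := V)
    ((Finsupp.linearCombination K v).domRestrict (Finsupp.supported K K (A : Set P)))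
  have h1 : LinearMap.range ((Finsupp.linearCombination K v).domRestrict
      (Finsupp.supported K K (A : Set P))) = Submodule.span K (v '' A) := by
    rw [LinearMap.range_domRestrict, Finsupp.span_image_eq_map_linearCombination]
  have h2 : relationsOn K v A = (LinearMap.ker ((Finsupp.linearCombination K v).domRestrict
      (Finsupp.supported K K (A : Set P)))).map (Submodule.subtype _) := by
    rw [LinearMap.ker_domRestrict, Submodule.map_comap_subtype]
    rfl
  rw [h1, (Finsupp.supportedEquivFinsupp (R := K) (M := K) (A : Set P)).finrank_eq] at h
  rw [h2, Submodule.finrank_map_subtype_eq, h]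
  simp

/-- The dimension of the space of relations on a positive support is the length of a maximal chain
of positive supports below it, so it is determined by the collection of positive supports. -/
theorem finrank_relationsOn_le {v : P → V} {w : P → W}
    (h : ∀ A, IsPosSupport K v A ↔ IsPosSupport K w A) {C : Finset P} (hC : IsPosSupport K v C) :
    Module.finrank K (relationsOn K v C) ≤ Module.finrank K (relationsOn K w C) := by
  classical
  induction C using Finset.strongInduction with
  | H C ih =>
    rcases C.eq_empty_or_nonempty with rfl | hne
    · have : relationsOn K v ∅ = ⊥ := by
        rw [eq_bot_iff]
        intro c hc
        simpa using (mem_relationsOn.1 hc).1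
      rw [this, finrank_bot]
      exact Nat.zero_le _
    obtain ⟨B, hB, hBmax⟩ := (C.ssubsets.filter fun B => IsPosSupport K v B).exists_max_image
      Finset.card ⟨∅, Finset.mem_filter.2
        ⟨Finset.mem_ssubsets.2 (Finset.empty_ssubset.2 hne), isPosSupport_empty v⟩⟩
    rw [Finset.mem_filter, Finset.mem_ssubsets] at hB
    obtain ⟨t, ht0, htC, ht⟩ := hC
    have h1 := relationsOn_le_sup_span hB.2 hB.1 (fun E hE hBE hEC =>
      (Finset.eq_of_subset_of_card_le hBE (hBmax E (by simp [hE, hEC]))).symm) ht0 htC ht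
    obtain ⟨s, hs0, hsC, hs⟩ := (h C).1 ⟨t, ht0, htC, ht⟩
    -- For `v` the dimension grows by at most one from `B` to `C`; for `w` by at least one, since a
    -- relation with full support `C` is not supported in `B`.
    have h2 : relationsOn K w B < relationsOn K w C := by
      refine lt_of_le_of_ne (relationsOn_mono w hB.1.1) fun heq => hB.1.2 ?_
      have : s ∈ relationsOn K w B := heq ▸ mem_relationsOn.2 ⟨hsC.le, hs⟩
      exact hsC ▸ (mem_relationsOn.1 this).1
    calc Module.finrank K (relationsOn K v C)
        ≤ Module.finrank K ↥(relationsOn K v B ⊔ Submodule.span K {t}) :=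
          Submodule.finrank_mono h1
      _ ≤ Module.finrank K (relationsOn K v B) + Module.finrank K (Submodule.span K {t}) :=
          Submodule.finrank_add_le_finrank_add_finrank _ _
      _ ≤ Module.finrank K (relationsOn K w B) + 1 :=
          add_le_add (ih B hB.1 hB.2) ((finrank_span_le_card _).trans (by simp))
      _ ≤ Module.finrank K (relationsOn K w C) := Submodule.finrank_lt_finrank_of_lt h2

theorem IsPosSupport.exists_superset {v : P → V} {Q : Set P} (hQ : ∀ p ∈ Q, ∃ A, p ∈ A ∧ ↑A ⊆ Q ∧ IsPosSupport K v A) (F : Finset P)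
    (hF : ↑F ⊆ Q) : ∃ A : Finset P, F ⊆ A ∧ ↑A ⊆ Q ∧ IsPosSupport K v A := by
  classical
  induction F using Finset.induction_on with
  | empty => exact ⟨∅, by simp, by simp, isPosSupport_empty v⟩
  | insert p F _ ih =>
    rw [Finset.coe_insert, Set.insert_subset_iff] at hF
    obtain ⟨A, hFA, hAQ, hA⟩ := ih hF.2
    obtain ⟨B, hpB, hBQ, hB⟩ := hQ p hF.1
    exact ⟨A ∪ B, Finset.insert_subset (Finset.mem_union_right _ hpB)
      (hFA.trans Finset.subset_union_left), by simp [hAQ, hBQ], hA.union hB⟩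

/-- Each `v p` lies in the span of a finite positive support inside `Q`, and `insert_iff` carries
this membership over to `w`. -/
theorem span_image_eq_top_of_isPosSupport_iff {v : P → V} {w : P → W}
    (h : ∀ A, IsPosSupport K v A ↔ IsPosSupport K w A) {Q : Set P}
    (hQ : ∀ p ∈ Q, ∃ A : Finset P, p ∈ A ∧ ↑A ⊆ Q ∧ IsPosSupport K v A)
    (hv : Submodule.span K (v '' Q) = ⊤) (hw : Submodule.span K (Set.range w) = ⊤) :
    Submodule.span K (w '' Q) = ⊤ := by
  classical
  rw [← top_le_iff, ← hw, Submodule.span_le]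
  rintro _ ⟨p, rfl⟩
  obtain ⟨a, ha, hap⟩ := (Finsupp.mem_span_image_iff_linearCombination K (s := Q)).1
    (hv ▸ Submodule.mem_top : v p ∈ Submodule.span K (v '' Q))
  obtain ⟨A, haA, hAQ, hA⟩ := IsPosSupport.exists_superset hQ a.support ha
  have h1 : v p ∈ Submodule.span K (v '' A) :=
    (Finsupp.mem_span_image_iff_linearCombination K).2 ⟨a, haA, hap⟩
  rw [← hA.insert_iff, h, ((h A).1 hA).insert_iff] at h1
  exact Submodule.span_mono (Set.image_mono hAQ) h1

theorem finrank_span_le_of_isPosSupport_iff {v : P → V} {w : P → W}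
    (h : ∀ A, IsPosSupport K v A ↔ IsPosSupport K w A) {A : Finset P} (hA : IsPosSupport K v A) :
    Module.finrank K (Submodule.span K (w '' A)) ≤ Module.finrank K (Submodule.span K (v '' A)) := by
  have h1 := finrank_span_add_finrank_relationsOn (K := K) v A
  have h2 := finrank_span_add_finrank_relationsOn (K := K) w A
  have h3 := finrank_relationsOn_le h hA
  omega

end PosSupport

-- Comparison of dimensions

universe x y z

/-- The collection of positive supports of a spanning family bounds the dimension. -/
theorem lift_rank_le_of_isPosSupport_iff {K : Type*} [Field K] [LinearOrder K]
    [IsStrictOrderedRing K] {P : Type x} {V : Type y} [AddCommGroup V] [Module K V]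
    {W : Type z} [AddCommGroup W] [Module K W] {v : P → V} {w : P → W}
    (h : ∀ A, IsPosSupport K v A ↔ IsPosSupport K w A)
    (hex : ∀ p, ∃ A, p ∈ A ∧ IsPosSupport K v A)
    (hv : Submodule.span K (Set.range v) = ⊤) (hw : Submodule.span K (Set.range w) = ⊤) :
    Cardinal.lift.{y} (Module.rank K W) ≤ Cardinal.lift.{z} (Module.rank K V) := by
  classical
  obtain ⟨κ, a, -, hspan, hli⟩ := exists_linearIndependent' K v
  rw [hv] at hspan
  have hrank := (Module.Basis.mk hli hspan.ge).mk_eq_rank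
  choose A hpA hA using hex
  rcases finite_or_infinite κ with hκ | hκ
  · have : Module.Finite K V := Module.Finite.of_basis (Module.Basis.mk hli hspan.ge)
    obtain ⟨B, hB, -, hBpos⟩ := IsPosSupport.exists_superset (K := K) (v := v) (Q := Set.univ)
      (fun p _ => ⟨A p, hpA p, Set.subset_univ _, hA p⟩) (Set.finite_range a).toFinset
      (Set.subset_univ _)
    have hBv : Submodule.span K (v '' B) = ⊤ := by
      rw [← top_le_iff, ← hspan, Set.range_comp]
      exact Submodule.span_mono (Set.image_mono (by simpa using hB))
    have hBw := span_image_eq_top_of_isPosSupport_iff h (Q := B)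
      (fun p hp => ⟨B, hp, subset_rfl, hBpos⟩) hBv hw
    have hle := finrank_span_le_of_isPosSupport_iff h hBpos
    have : Module.Finite K W :=
      Module.finite_def.2 (hBw ▸ Submodule.fg_span (B.finite_toSet.image w))
    rw [hBv, hBw, finrank_top, finrank_top] at hle
    rw [← Module.finrank_eq_rank, ← Module.finrank_eq_rank]
    simpa only [Cardinal.lift_natCast, Nat.cast_le] using hle
  -- Enlarging the basis by finite positive supports does not change its infinite cardinality.
  · set Q : Set P := ⋃ i, (A (a i) : Set P) with hQ
    have hQv : Submodule.span K (v '' Q) = ⊤ := by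
      rw [← top_le_iff, ← hspan, Set.range_comp]
      refine Submodule.span_mono (Set.image_mono ?_)
      rintro _ ⟨i, rfl⟩
      exact Set.mem_iUnion.2 ⟨i, hpA _⟩
    have hQw := span_image_eq_top_of_isPosSupport_iff h (Q := Q) (fun p hp => by
      obtain ⟨i, hi⟩ := Set.mem_iUnion.1 hp
      exact ⟨A (a i), hi, Set.subset_iUnion (fun i => (A (a i) : Set P)) i, hA _⟩) hQv hw
    have h1 : Module.rank K W ≤ Cardinal.mk (w '' Q) := by
      rw [← rank_top K W, ← hQw]
      exact rank_span_le _
    have h2 : Cardinal.mk Q ≤ Cardinal.mk κ := by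
      refine (Cardinal.mk_iUnion_le _).trans ?_
      refine (mul_le_mul_right (ciSup_le' (a := Cardinal.aleph0) fun i => ?_) _).trans ?_
      · exact (Cardinal.lt_aleph0_of_finite _).le
      · exact (Cardinal.mul_aleph0_eq (Cardinal.aleph0_le_mk κ)).le
    have h3 := Cardinal.mk_image_le_lift (f := w) (s := Q)
    refine Cardinal.lift_le.{x}.1 ?_
    calc Cardinal.lift.{x} (Cardinal.lift.{y} (Module.rank K W))
        ≤ Cardinal.lift.{x} (Cardinal.lift.{y} (Cardinal.mk (w '' Q))) := by simpa using h1
      _ = Cardinal.lift.{y} (Cardinal.lift.{x} (Cardinal.mk (w '' Q))) :=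
          by simp only [Cardinal.lift_lift]
      _ ≤ Cardinal.lift.{y} (Cardinal.lift.{z} (Cardinal.mk Q)) := Cardinal.lift_le.2 h3
      _ ≤ Cardinal.lift.{y} (Cardinal.lift.{z} (Cardinal.mk κ)) := by simpa using h2
      _ = Cardinal.lift.{z} (Cardinal.lift.{y} (Cardinal.mk κ)) := by simp only [Cardinal.lift_lift]
      _ = Cardinal.lift.{z} (Cardinal.lift.{x} (Module.rank K V)) := by rw [hrank]
      _ = Cardinal.lift.{x} (Cardinal.lift.{z} (Module.rank K V)) := by simp only [Cardinal.lift_lift]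

/-! ### Order isomorphisms between families of finite sets -/

section FinsetFamilies

variable {P P' : Type*} {S : Set (Finset P)} {S' : Set (Finset P')}

theorem exists_forall_notMem_of_orderIso [DecidableEq P]
    (hunion : ∀ A ∈ S, ∀ B ∈ S, A ∪ B ∈ S) (hcov : ∀ p, ∃ A ∈ S, p ∈ A)
    (hsep : ∀ F p, p ∉ F → ∃ A ∈ S, F ⊆ A ∧ p ∉ A) (e : S ≃o S') (p : P) :
    ∃ p', ∀ A : S, p ∉ A.1 → p' ∉ (e A).1 := by
  classical
  -- Otherwise every point lies in the image of a member avoiding `p`. A union of such members has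
  -- image containing that of some `A` with `p ∈ A`, so it contains `p`.
  by_contra! H
  have key : ∀ F : Finset P', ∃ U : S, p ∉ U.1 ∧ F ⊆ (e U).1 := by
    intro F
    induction F using Finset.induction_on with
    | empty =>
      obtain ⟨A, hA, -, hp⟩ := hsep ∅ p (Finset.notMem_empty p)
      exact ⟨⟨A, hA⟩, hp, Finset.empty_subset _⟩
    | insert q F _ ih =>
      obtain ⟨U, hpU, hFU⟩ := ih
      obtain ⟨B, hpB, hqB⟩ := H q
      have h1 : (e U).1 ⊆ (e ⟨U.1 ∪ B.1, hunion _ U.2 _ B.2⟩).1 :=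
        e.monotone (Subtype.mk_le_mk.2 Finset.subset_union_left)
      have h2 : (e B).1 ⊆ (e ⟨U.1 ∪ B.1, hunion _ U.2 _ B.2⟩).1 :=
        e.monotone (Subtype.mk_le_mk.2 Finset.subset_union_right)
      exact ⟨⟨U.1 ∪ B.1, hunion _ U.2 _ B.2⟩, by simp [hpU, hpB],
        Finset.insert_subset (h2 hqB) (hFU.trans h1)⟩
  obtain ⟨A, hA, hpA⟩ := hcov p
  obtain ⟨U, hpU, hU⟩ := key (e ⟨A, hA⟩).1
  have hAU : (⟨A, hA⟩ : S) ≤ U := e.le_iff_le.1 hU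
  exact hpU (hAU hpA)

/-- An order isomorphism between two families of finite sets that are closed under unions and
separate points from finite sets is induced by a bijection of the underlying types. -/
theorem exists_equiv_of_orderIso [DecidableEq P] [DecidableEq P']
    (hunion : ∀ A ∈ S, ∀ B ∈ S, A ∪ B ∈ S) (hcov : ∀ p, ∃ A ∈ S, p ∈ A)
    (hsep : ∀ F p, p ∉ F → ∃ A ∈ S, F ⊆ A ∧ p ∉ A)
    (hunion' : ∀ A ∈ S', ∀ B ∈ S', A ∪ B ∈ S') (hcov' : ∀ p, ∃ A ∈ S', p ∈ A)
    (hsep' : ∀ F p, p ∉ F → ∃ A ∈ S', F ⊆ A ∧ p ∉ A) (e : S ≃o S') :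
    ∃ σ : P ≃ P', ∀ A : Finset P, A ∈ S ↔ A.map σ.toEmbedding ∈ S' := by
  choose f hf using exists_forall_notMem_of_orderIso hunion hcov hsep e
  choose g hg using exists_forall_notMem_of_orderIso hunion' hcov' hsep' e.symm
  have hgf : ∀ p, g (f p) = p := by
    intro p
    by_contra hne
    obtain ⟨A, hA, hgA, hpA⟩ := hsep {g (f p)} p (by simpa using Ne.symm hne)
    refine hg (f p) (e ⟨A, hA⟩) (hf p ⟨A, hA⟩ hpA) ?_
    rw [e.symm_apply_apply]
    exact hgA (Finset.mem_singleton_self _)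
  have hfg : ∀ p, f (g p) = p := by
    intro p
    by_contra hne
    obtain ⟨A, hA, hfA, hpA⟩ := hsep' {f (g p)} p (by simpa using Ne.symm hne)
    refine hf (g p) (e.symm ⟨A, hA⟩) (hg p ⟨A, hA⟩ hpA) ?_
    rw [e.apply_symm_apply]
    exact hfA (Finset.mem_singleton_self _)
  have key : ∀ (A : S) p, f p ∈ (e A).1 ↔ p ∈ A.1 := by
    refine fun A p => ⟨fun h => by_contra fun hp => hf p A hp h, fun h => by_contra fun hp => ?_⟩
    have := hg (f p) (e A) hp
    rw [e.symm_apply_apply, hgf] at this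
    exact this h
  let σ : P ≃ P' := ⟨f, g, hgf, hfg⟩
  have hmap : ∀ A : S, A.1.map σ.toEmbedding = (e A).1 := by
    intro A
    ext q
    rw [Finset.mem_map_equiv, ← key, show f (σ.symm q) = q from hfg q]
  refine ⟨σ, fun A => ⟨fun hA => hmap ⟨A, hA⟩ ▸ (e ⟨A, hA⟩).2, fun hA => ?_⟩⟩
  have h := hmap (e.symm ⟨_, hA⟩)
  rw [e.apply_symm_apply] at h
  rw [← Finset.map_injective _ h]
  exact (e.symm ⟨_, hA⟩).2

end FinsetFamilies

/-! ### Principal loci and classes in a Dedekind domain -/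

open IsDedekindDomain nonZeroDivisors

section Dedekind

variable {D : Type*} [CommRing D] [IsDedekindDomain D]

/-- The finite sets of maximal ideals that are the zero locus of some nonzero element. -/
def principalLoci (D : Type*) [CommRing D] [IsDedekindDomain D] :
    Set (Finset (HeightOneSpectrum D)) :=
  {A | ∃ x : D, x ≠ 0 ∧ ∀ p, p ∈ A ↔ x ∈ p.asIdeal}

theorem exists_mem_principalLoci {x : D} (hx : x ≠ 0) :
    ∃ A ∈ principalLoci D, ∀ p, p ∈ A ↔ x ∈ p.asIdeal := by
  have hfin := Ideal.finite_factors (I := Ideal.span {x}) (by simpa using hx)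
  refine ⟨hfin.toFinset, ⟨x, hx, fun p => ?_⟩, fun p => ?_⟩ <;>
  simp [Ideal.dvd_span_singleton]

omit [IsDedekindDomain D] in
theorem radical_span_singleton_le_iff {x y : D} (hy : y ≠ 0) :
    (Ideal.span {x}).radical ≤ (Ideal.span {y}).radical ↔
      ∀ p : HeightOneSpectrum D, y ∈ p.asIdeal → x ∈ p.asIdeal := by
  constructor
  · intro h p hp
    exact (p.isPrime.radical_le_iff.2 ((Ideal.span_singleton_le_iff_mem _).2 hp))
      (h (Ideal.le_radical (Ideal.mem_span_singleton_self x)))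
  · intro h
    -- The radical is the intersection of the primes above `y`, all nonzero because `y ≠ 0`.
    rw [Ideal.radical_le_radical_iff, Ideal.span_singleton_le_iff_mem, Ideal.radical_eq_sInf,
      Submodule.mem_sInf]
    rintro J ⟨hJ, hJp⟩
    rw [Ideal.span_singleton_le_iff_mem] at hJ
    exact h ⟨J, hJp, fun h0 => hy (by simpa [h0] using hJ)⟩ hJ

/-- Passing to zero loci is an order-reversing bijection from radicals of nonzero principal ideals
to principal loci. -/
theorem nonempty_orderIso_principalLoci (D : Type*) [CommRing D] [IsDedekindDomain D] :
    Nonempty (principalLoci D ≃o (radPrincipal D)ᵒᵈ) := by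
  choose x hx0 hx using fun A : principalLoci D => A.2
  let f : principalLoci D ↪o (radPrincipal D)ᵒᵈ := OrderEmbedding.ofMapLEIff
    (fun A => OrderDual.toDual ⟨(Ideal.span {x A}).radical, x A, hx0 A, rfl⟩) (fun A B => by
      refine (radical_span_singleton_le_iff (hx0 A)).trans ?_
      exact forall_congr' fun p => by rw [← hx, ← hx])
  refine ⟨RelIso.ofSurjective f fun I => ?_⟩
  obtain ⟨_, y, hy, rfl⟩ := I
  obtain ⟨A, hA, hAy⟩ := exists_mem_principalLoci hy
  refine ⟨⟨A, hA⟩, congrArg OrderDual.toDual (Subtype.ext (le_antisymm ?_ ?_))⟩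
  · exact (radical_span_singleton_le_iff hy).2 fun p hp => by
      rw [← hx]; exact (hAy p).2 hp
  · exact (radical_span_singleton_le_iff (hx0 _)).2 fun p hp => by
      rw [← hx] at hp; exact (hAy p).1 hp

theorem union_mem_principalLoci [DecidableEq (HeightOneSpectrum D)] :
    ∀ A ∈ principalLoci D, ∀ B ∈ principalLoci D, A ∪ B ∈ principalLoci D := by
  rintro A ⟨x, hx, hA⟩ B ⟨y, hy, hB⟩
  exact ⟨x * y, mul_ne_zero hx hy, fun p => by
    rw [Finset.mem_union, hA, hB, p.isPrime.mul_mem_iff_mem_or_mem]⟩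

theorem exists_principalLoci_mem (p : HeightOneSpectrum D) : ∃ A ∈ principalLoci D, p ∈ A := by
  obtain ⟨x, hxp, hx⟩ := Submodule.exists_mem_ne_zero_of_ne_bot p.ne_bot
  obtain ⟨A, hA, h⟩ := exists_mem_principalLoci hx
  exact ⟨A, hA, (h p).2 hxp⟩

theorem exists_principalLoci_superset_notMem (F : Finset (HeightOneSpectrum D))
    (p : HeightOneSpectrum D) (hp : p ∉ F) : ∃ A ∈ principalLoci D, F ⊆ A ∧ p ∉ A := by
  have h1 : ¬ ∏ q ∈ F, q.asIdeal ≤ p.asIdeal := by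
    rw [p.isPrime.prod_le]
    rintro ⟨q, hq, hqp⟩
    have : q = p := HeightOneSpectrum.ext (q.isMaximal.eq_of_le p.isPrime.ne_top hqp)
    exact hp (this ▸ hq)
  obtain ⟨x, hx, hxp⟩ := SetLike.not_le_iff_exists.1 h1
  obtain ⟨A, hA, h⟩ := exists_mem_principalLoci (x := x) (by rintro rfl; exact hxp (zero_mem _))
  exact ⟨A, hA, fun q hq => (h q).2 (Ideal.le_of_dvd (Finset.dvd_prod_of_mem _ hq) hx),
    fun hpA => hxp ((h p).1 hpA)⟩

/-- A maximal ideal, as a nonzero ideal. -/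
def HeightOneSpectrum.toNonZeroDivisors (p : HeightOneSpectrum D) : (Ideal D)⁰ :=
  ⟨p.asIdeal, mem_nonZeroDivisors_of_ne_zero p.ne_bot⟩

/-- The product of powers of maximal ideals with prescribed exponents. -/
noncomputable def primePowerProd (n : HeightOneSpectrum D →₀ ℕ) : (Ideal D)⁰ :=
  n.prod fun p k => HeightOneSpectrum.toNonZeroDivisors p ^ k

theorem coe_primePowerProd (n : HeightOneSpectrum D →₀ ℕ) :
    (primePowerProd n : Ideal D) = n.prod fun p k => p.asIdeal ^ k := by
  simp [primePowerProd, Finsupp.prod, HeightOneSpectrum.toNonZeroDivisors]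

theorem primePowerProd_surjective : Function.Surjective (primePowerProd (D := D)) := by
  classical
  rintro ⟨I, hI⟩
  induction I using UniqueFactorizationMonoid.induction_on_prime with
  | h₁ => exact absurd rfl (nonZeroDivisors.ne_zero hI)
  | h₂ I hu =>
    exact ⟨0, Subtype.ext (by
      simpa [coe_primePowerProd] using (Ideal.isUnit_iff.1 hu).symm)⟩
  | h₃ I J h0 hJ ih =>
    obtain ⟨n, hn⟩ := ih (mem_nonZeroDivisors_of_ne_zero h0)
    refine ⟨n + Finsupp.single ⟨J, Ideal.isPrime_of_prime hJ, hJ.ne_zero⟩ 1, Subtype.ext ?_⟩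
    have hn' := congrArg Subtype.val hn
    rw [coe_primePowerProd] at hn' ⊢
    rw [Finsupp.prod_add_index' (by simp) (by simp [pow_add]), hn', mul_comm]
    simp

theorem primePowerProd_le_iff (n : HeightOneSpectrum D →₀ ℕ) (p : HeightOneSpectrum D) :
    (primePowerProd n : Ideal D) ≤ p.asIdeal ↔ p ∈ n.support := by
  rw [coe_primePowerProd, Finsupp.prod, p.isPrime.prod_le]
  constructor
  · rintro ⟨q, hq, hqp⟩
    have : q = p := HeightOneSpectrum.ext
      (q.isMaximal.eq_of_le p.isPrime.ne_top (p.isPrime.le_of_pow_le hqp))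
    exact this ▸ hq
  · exact fun hp => ⟨p, hp, Ideal.pow_le_self (Finsupp.mem_support_iff.1 hp)⟩

/-- The class of a maximal ideal in the class group tensored with the rationals. -/
noncomputable def rationalClass (p : HeightOneSpectrum D) :
    ℚ ⊗[ℤ] Additive (ClassGroup D) :=
  1 ⊗ₜ Additive.ofMul (ClassGroup.mk0 (HeightOneSpectrum.toNonZeroDivisors p))

theorem linearCombination_rationalClass (n : HeightOneSpectrum D →₀ ℕ) :
    Finsupp.linearCombination ℚ rationalClass (n.mapRange (Nat.cast : ℕ → ℚ) Nat.cast_zero) =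
      1 ⊗ₜ[ℤ] Additive.ofMul (ClassGroup.mk0 (primePowerProd n)) := by
  rw [Finsupp.linearCombination_apply, Finsupp.sum_mapRange_index (by simp), primePowerProd,
    Finsupp.prod, map_prod, ofMul_prod, TensorProduct.tmul_sum]
  refine Finset.sum_congr rfl fun p _ => ?_
  beta_reduce
  rw [map_pow, ofMul_pow, Nat.cast_smul_eq_nsmul, rationalClass, ← TensorProduct.tmul_smul]

theorem span_range_rationalClass :
    Submodule.span ℚ (Set.range (rationalClass (D := D))) = ⊤ := by
  rw [eq_top_iff]
  rintro z -
  induction z using TensorProduct.induction_on with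
  | zero => exact zero_mem _
  | add x y hx hy => exact add_mem hx hy
  | tmul q g =>
    obtain ⟨I, hI⟩ := ClassGroup.mk0_surjective g.toMul
    obtain ⟨n, rfl⟩ := primePowerProd_surjective I
    have h1 : q ⊗ₜ[ℤ] g = q • (1 : ℚ) ⊗ₜ[ℤ] Additive.ofMul (ClassGroup.mk0 (primePowerProd n)) := by
      rw [hI, TensorProduct.smul_tmul', smul_eq_mul, mul_one]; rfl
    rw [h1, ← linearCombination_rationalClass]
    refine Submodule.smul_mem _ _ ?_
    rw [← Finsupp.range_linearCombination]
    exact LinearMap.mem_range_self _ _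

/-- Tensoring with `ℚ` localizes at the nonzero integers, so only torsion dies. -/
theorem exists_nsmul_eq_zero_of_one_tmul_eq_zero {G : Type*} [AddCommGroup G] {g : G}
    (hg : (1 : ℚ) ⊗ₜ[ℤ] g = 0) : ∃ m : ℕ, m ≠ 0 ∧ m • g = 0 := by
  obtain ⟨m, hm⟩ := (IsLocalizedModule.eq_zero_iff ℤ⁰ (TensorProduct.mk ℤ ℚ G 1)).1 hg
  refine ⟨(m : ℤ).natAbs, Int.natAbs_ne_zero.2 (nonZeroDivisors.coe_ne_zero m), ?_⟩
  have hm' : (m : ℤ) • g = 0 := hm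
  rcases Int.natAbs_eq (m : ℤ) with h | h
  · rw [h] at hm'; simpa using hm'
  · rw [h] at hm'; simpa using hm'

/-- Clearing denominators in a finitely supported nonnegative rational function. -/
theorem exists_nat_smul_eq_mapRange {P : Type*} (c : P →₀ ℚ) (hc : ∀ p, 0 ≤ c p) :
    ∃ (N : ℕ) (n : P →₀ ℕ), n.support = c.support ∧
      n.mapRange (Nat.cast : ℕ → ℚ) Nat.cast_zero = (N : ℚ) • c := by
  classical
  set N := ∏ p ∈ c.support, (c p).den with hN
  have hN0 : N ≠ 0 := Finset.prod_ne_zero_iff.2 fun p _ => (c p).den_nz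
  have hdvd : ∀ p, (c p).den ∣ N := by
    intro p
    by_cases hp : p ∈ c.support
    · exact Finset.dvd_prod_of_mem _ hp
    · simp [Finsupp.notMem_support_iff.1 hp]
  have key : ∀ p, (((c p).num.toNat * (N / (c p).den) : ℕ) : ℚ) = N * c p := by
    intro p
    have h1 : (((c p).num.toNat : ℕ) : ℚ) = (c p).num := by
      exact_mod_cast Int.toNat_of_nonneg (Rat.num_nonneg.2 (hc p))
    rw [Nat.cast_mul, Nat.cast_div (hdvd p) (by simp), h1]
    conv_rhs => rw [← Rat.num_div_den (c p)]
    ring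
  refine ⟨N, Finsupp.onFinset c.support (fun p => (c p).num.toNat * (N / (c p).den)) ?_, ?_, ?_⟩
  · intro p hp
    rw [Finsupp.mem_support_iff]
    intro h
    simp [h] at hp
  · ext p
    have := key p
    rw [Finsupp.mem_support_iff, Finsupp.mem_support_iff, Finsupp.onFinset_apply,
      ← Nat.cast_ne_zero (R := ℚ), this]
    simp [hN0]
  · ext p
    simpa using key p

theorem mem_principalLoci_iff_isPosSupport (A : Finset (HeightOneSpectrum D)) :
    A ∈ principalLoci D ↔ IsPosSupport ℚ (rationalClass (D := D)) A := by
  constructor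
  · rintro ⟨x, hx, hA⟩
    have hx' : Ideal.span {x} ≠ 0 := by simpa using hx
    obtain ⟨n, hn⟩ := primePowerProd_surjective ⟨_, mem_nonZeroDivisors_of_ne_zero hx'⟩
    refine ⟨n.mapRange (Nat.cast : ℕ → ℚ) Nat.cast_zero, fun p => by simp, ?_, ?_⟩
    · rw [Finsupp.support_mapRange_of_injective _ _ Nat.cast_injective]
      ext p
      rw [← primePowerProd_le_iff, hn, hA, Ideal.span_singleton_le_iff_mem]
    · rw [linearCombination_rationalClass, hn, (ClassGroup.mk0_eq_one_iff _).2 ⟨x, rfl⟩]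
      simp
  · rintro ⟨c, hc0, rfl, hc⟩
    obtain ⟨N, n, hsupp, hn⟩ := exists_nat_smul_eq_mapRange c hc0
    have h1 := linearCombination_rationalClass n
    rw [hn, map_smul, hc, smul_zero] at h1
    -- The `m`-th power of the ideal is principal and has the same zero locus; its generator is the
    -- required element.
    obtain ⟨m, hm0, hm⟩ := exists_nsmul_eq_zero_of_one_tmul_eq_zero h1.symm
    rw [← ofMul_pow, ofMul_eq_zero, ← map_pow] at hm
    obtain ⟨x, hx⟩ := ((ClassGroup.mk0_eq_one_iff (primePowerProd n ^ m).2).1 hm).principal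
    refine ⟨x, ?_, fun p => ?_⟩
    · rintro rfl
      exact nonZeroDivisors.ne_zero (primePowerProd n ^ m).2 (by simpa using hx)
    · rw [← Ideal.span_singleton_le_iff_mem, ← Ideal.submodule_span_eq, ← hx, ← hsupp,
        ← primePowerProd_le_iff, SubmonoidClass.coe_pow]
      exact ⟨(Ideal.pow_le_self hm0).trans, p.isPrime.le_of_pow_le⟩

end Dedekind

/-! ### Transport along the bijection and conclusion -/

theorem IsPosSupport.map_iff {K : Type*} [Field K] [LinearOrder K] {P P' V : Type*}
    [AddCommGroup V] [Module K V] (σ : P ≃ P') (v : P' → V) (A : Finset P) :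
    IsPosSupport K v (A.map σ.toEmbedding) ↔ IsPosSupport K (v ∘ σ) A := by
  constructor
  · rintro ⟨c, hc0, hcA, hc⟩
    refine ⟨c.equivMapDomain σ.symm, fun p => hc0 _, ?_, ?_⟩
    · ext p
      rw [Finsupp.mem_support_iff, Finsupp.equivMapDomain_apply, Equiv.symm_symm,
        ← Finsupp.mem_support_iff, hcA]
      simp
    · rw [Finsupp.linearCombination_equivMapDomain, ← hc]
      congr 2
      ext p
      simp
  · rintro ⟨c, hc0, rfl, hc⟩
    exact ⟨c.equivMapDomain σ, fun p => hc0 _, rfl, by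
      rw [Finsupp.linearCombination_equivMapDomain, hc]⟩

theorem lift_abelianRank_classGroup_le {D : Type u} {D' : Type v}
    [CommRing D] [IsDedekindDomain D] [CommRing D'] [IsDedekindDomain D']
    (h : Nonempty (radPrincipal D ≃o radPrincipal D')) :
    Cardinal.lift.{u} (abelianRank (Additive (ClassGroup D'))) ≤
      Cardinal.lift.{v} (abelianRank (Additive (ClassGroup D))) := by
  classical
  obtain ⟨e⟩ := h
  obtain ⟨f⟩ := nonempty_orderIso_principalLoci D
  obtain ⟨f'⟩ := nonempty_orderIso_principalLoci D'
  obtain ⟨σ, hσ⟩ := exists_equiv_of_orderIso union_mem_principalLoci exists_principalLoci_mem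
    exists_principalLoci_superset_notMem union_mem_principalLoci exists_principalLoci_mem
    exists_principalLoci_superset_notMem ((f.trans e.dual).trans f'.symm)
  refine lift_rank_le_of_isPosSupport_iff (v := rationalClass (D := D))
    (w := rationalClass (D := D') ∘ σ) (fun A => ?_) (fun p => ?_) span_range_rationalClass ?_
  · rw [← mem_principalLoci_iff_isPosSupport, hσ, mem_principalLoci_iff_isPosSupport,
      IsPosSupport.map_iff]
  · obtain ⟨A, hA, hp⟩ := exists_principalLoci_mem p
    exact ⟨A, hp, (mem_principalLoci_iff_isPosSupport A).1 hA⟩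
  · rw [EquivLike.range_comp, span_range_rationalClass]

theorem mainTheorem1 {D : Type u} {D' : Type v}
    [CommRing D] [IsDedekindDomain D] [CommRing D'] [IsDedekindDomain D']
    (h : Nonempty (radPrincipal D ≃o radPrincipal D')) :
    Cardinal.lift.{v} (abelianRank (Additive (ClassGroup D))) =
      Cardinal.lift.{u} (abelianRank (Additive (ClassGroup D'))) :=
  le_antisymm (lift_abelianRank_classGroup_le ⟨h.some.symm⟩) (lift_abelianRank_classGroup_le h)
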